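/- Work in the standard asynchronous shared-memory model with one writer and some finite number of readers, which are deterministic processes that may stop at any time and that communicate only through $n$ physical registers, by atomic steps each of which is a read or a write of one register. Each physical register is single-writer, that is, at most one process ever writes to it, and register $i$ can hold $b_i$ values; the \emph{total fanout} is $\sum_{i=1}^{n} b_i$. Such an algorithm implements an $m$-valued \emph{regular} single-writer register (with some initial value) if the writer can perform write operations with any of the $m$ values, the readers can perform read operations, and in every execution each read operation returns either the value written by the last write operation completed before the read began (the initial value if there is none) or the value written by some write operation concurrent with the read. It is \emph{obstruction-free} if at every point of every execution, every pending operation terminates after finitely many steps when its process runs alone. A reader is \emph{invisible} if it never writes to a physical register. Let $E(m,n,S)$ say that there is an obstruction-free implementation of an $m$-valued regular single-writer register from $n$ atomic single-writer physical registers with total fanout $S$ in which at least one reader is invisible. Then for all natural numbers $m,n,S$: 1. if $m\ge 2$ and $E(m,n,S)$, then $E(m-1,n,S-1)$ (in particular $S\ge 1$); 2. if $E(m,n,S)$, then $S-n+1\ge m$. -/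

import Mathlib

namespace RegImpl

/-- The processes: one writer and `r` readers. -/
inductive Proc (r : ℕ) where
  | writer : Proc r
  | reader : Fin r → Proc r
  deriving DecidableEq

/-- Argument of the high-level operation of a process: the writer's operation is given the value
to be written, a read operation has no argument. -/
abbrev Arg (m : ℕ) {r : ℕ} : Proc r → Type
  | .writer => Fin m
  | .reader _ => Unit

/-- Response of the high-level operation of a process: a write is acknowledged, a read operation
returns a value. -/
abbrev Resp (m : ℕ) {r : ℕ} : Proc r → Type
  | .writer => Unit
  | .reader _ => Fin m

/-- What a process does next during an operation, `σ` being its set of local states: read a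
physical register (the new local state depends on the value read), write a value to a physical
register, or finish the operation with a response. Register `i` can hold `b i` values. -/
inductive Action {n : ℕ} (b : Fin n → ℕ) (out σ : Type) where
  | read (i : Fin n) (k : Fin (b i) → σ)
  | write (i : Fin n) (x : Fin (b i)) (s : σ)
  | ret (o : out) (s : σ)

/-- The deterministic program of one process. The local state may persist between operations. -/
structure Program {n : ℕ} (b : Fin n → ℕ) (inp out : Type) where
  State : Type
  init : State
  invoke : inp → State → State
  act : State → Action b out State

end RegImpl

open RegImpl in
/-- An algorithm for one writer and `r` readers that is meant to simulate a register with `m`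
values by `n` physical registers, the `i`-th of which can hold `b i` values. -/
structure RegImpl (m n : ℕ) where
  r : ℕ
  b : Fin n → ℕ
  /-- the initial value of the simulated register -/
  initVal : Fin m
  /-- the initial values of the physical registers -/
  initMem : ∀ i, Fin (b i)
  prog : ∀ q : Proc r, Program b (Arg m q) (Resp m q)

namespace RegImpl

variable {m n : ℕ}

/-- Events: invocations and responses of high-level operations, and steps, each of which is a
read or a write of one physical register. -/
inductive Event (m n r : ℕ) where
  | inv (q : Proc r) (a : Arg m q)
  | ret (q : Proc r) (o : Resp m q)
  | physRead (q : Proc r) (i : Fin n)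
  | physWrite (q : Proc r) (i : Fin n)

/-- The process that performs an event. -/
def Event.proc {r : ℕ} : Event m n r → Proc r
  | .inv q _ => q
  | .ret q _ => q
  | .physRead q _ => q
  | .physWrite q _ => q

/-- A configuration: contents of the physical registers, local states of the processes, and
which of them have an operation in progress. -/
structure Config (A : RegImpl m n) where
  mem : ∀ i, Fin (A.b i)
  state : ∀ q, (A.prog q).State
  busy : Proc A.r → Bool

/-- The initial configuration. -/
def initConfig (A : RegImpl m n) : A.Config where
  mem := A.initMem
  state := fun q => (A.prog q).init
  busy := fun _ => false

/-- `A.Step C e C'`: event `e` can occur in configuration `C` and leads to `C'`. -/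
inductive Step (A : RegImpl m n) : A.Config → Event m n A.r → A.Config → Prop
  | inv (C : A.Config) (q : Proc A.r) (a : Arg m q) (hq : C.busy q = false) :
      Step A C (.inv q a)
        { mem := C.mem
          state := Function.update C.state q ((A.prog q).invoke a (C.state q))
          busy := Function.update C.busy q true }
  | physRead (C : A.Config) (q : Proc A.r) (i : Fin n) (k : Fin (A.b i) → (A.prog q).State)
      (hq : C.busy q = true) (hact : (A.prog q).act (C.state q) = .read i k) :
      Step A C (.physRead q i)
        { mem := C.mem
          state := Function.update C.state q (k (C.mem i))
          busy := C.busy }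
  | physWrite (C : A.Config) (q : Proc A.r) (i : Fin n) (x : Fin (A.b i))
      (s : (A.prog q).State)
      (hq : C.busy q = true) (hact : (A.prog q).act (C.state q) = .write i x s) :
      Step A C (.physWrite q i)
        { mem := Function.update C.mem i x
          state := Function.update C.state q s
          busy := C.busy }
  | ret (C : A.Config) (q : Proc A.r) (o : Resp m q) (s : (A.prog q).State)
      (hq : C.busy q = true) (hact : (A.prog q).act (C.state q) = .ret o s) :
      Step A C (.ret q o)
        { mem := C.mem
          state := Function.update C.state q s
          busy := Function.update C.busy q false }

/-- `A.ExecFrom C h C'`: the sequence of events `h` leads from `C` to `C'`. -/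
inductive ExecFrom (A : RegImpl m n) : A.Config → List (Event m n A.r) → A.Config → Prop
  | nil (C : A.Config) : ExecFrom A C [] C
  | cons {C C' C'' : A.Config} {e : Event m n A.r} {h : List (Event m n A.r)}
      (h₁ : A.Step C e C') (h₂ : ExecFrom A C' h C'') : ExecFrom A C (e :: h) C''

/-- `A.Exec h C`: `h` is the sequence of events of a finite execution, started in the initial
configuration, that ends in `C`. -/
def Exec (A : RegImpl m n) (h : List (Event m n A.r)) (C : A.Config) : Prop :=
  A.ExecFrom A.initConfig h C

/-- `v` is the value written by the last write operation completed during `h`, or the initial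
value `v₀` if no write operation is completed during `h`. -/
def LastCompleted {r : ℕ} (v₀ : Fin m) (h : List (Event m n r)) (v : Fin m) : Prop :=
  (.ret .writer () ∉ h ∧ v = v₀) ∨
  ∃ h₁ h₂ h₃, h = h₁ ++ .inv .writer v :: (h₂ ++ .ret .writer () :: h₃) ∧
    (∀ w, .inv .writer w ∉ h₂) ∧ .ret .writer () ∉ h₃

/-- At the end of `h`, a write operation with value `v` is in progress. -/
def PendingWrite {r : ℕ} (h : List (Event m n r)) (v : Fin m) : Prop :=
  ∃ h₁ h₂, h = h₁ ++ .inv .writer v :: h₂ ∧ .ret .writer () ∉ h₂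

/-- The simulated register is regular: whenever a read operation is invoked after the events
`h₁` and returns `v` after the further events `h₂`, the value `v` was written by the last write
operation completed before the read, or by a write operation concurrent with the read. -/
def Regular (A : RegImpl m n) : Prop :=
  ∀ (j : Fin A.r) (v : Fin m) (h₁ h₂ : List (Event m n A.r)) (C : A.Config),
    A.Exec (h₁ ++ .inv (.reader j) () :: (h₂ ++ [.ret (.reader j) v])) C →
    .inv (.reader j) () ∉ h₂ →
    LastCompleted A.initVal h₁ v ∨ PendingWrite h₁ v ∨ .inv .writer v ∈ h₂

/-- Obstruction-freedom: from every reachable configuration, every process that runs alone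
finishes its operation (if it has one in progress) in finitely many steps. As programs are
deterministic, there is only one way in which a process can proceed with its operation. -/
def ObstructionFree (A : RegImpl m n) : Prop :=
  ∀ (h : List (Event m n A.r)) (C : A.Config), A.Exec h C → ∀ q : Proc A.r,
    ∃ h' C', A.ExecFrom C h' C' ∧ (∀ e ∈ h', e.proc = q) ∧ C'.busy q = false

/-- The physical registers are single-writer: each has an owner, the only process that ever
writes to it. -/
def SingleWriter (A : RegImpl m n) : Prop :=
  ∀ i : Fin n, ∃ owner : Proc A.r, ∀ (h : List (Event m n A.r)) (C : A.Config), A.Exec h C →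
    ∀ q : Proc A.r, .physWrite q i ∈ h → q = owner

/-- Reader `j` is invisible: it never writes to a physical register. -/
def Invisible (A : RegImpl m n) (j : Fin A.r) : Prop :=
  ∀ (h : List (Event m n A.r)) (C : A.Config), A.Exec h C →
    ∀ i : Fin n, .physWrite (.reader j) i ∉ h

/-- The total fanout: the sum of the numbers of values of the physical registers. -/
def totalFanout (A : RegImpl m n) : ℕ := ∑ i, A.b i

/-- `E m n S`: there is an obstruction-free implementation of an `m`-valued regular single-writer
register from `n` atomic single-writer registers with total fanout `S` in which at least one
reader is invisible. -/
def E (m n S : ℕ) : Prop :=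
  ∃ A : RegImpl m n, A.SingleWriter ∧ A.Regular ∧ A.ObstructionFree ∧
    (∃ j, A.Invisible j) ∧ A.totalFanout = S

end RegImpl

/-! Fix a value `v` other than the initial one and an invisible reader `j`. Suppose the other
processes could always, without writing `v`, bring any register to any of its values. Take a solo
write of `v` followed by a solo read by `j`, which must return `v`. Since `j` never writes, the
others cannot notice it. Before each of its reads they can therefore supply the very value seen in
that run (`replay`). So `j` returns `v` although `v` was never written, against regularity.

Hence some reachable configuration, with `v` not yet written, has a register `i` that can never
again take a certain value `x` unless `v` is written (`exists_unreachable_value`).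
Obstruction-freedom lets all pending operations finish from there (`ObstructionFree.exists_idle`).
Restarting the algorithm at the resulting idle configuration, with `v` deleted from the simulated
register and `x` from register `i`, loses nothing (`Lossless`) and lowers both the number of values
and the total fanout by one (`E.pred`).

Iterating down to a single value leaves the bound that each of the `n` registers holds at least one
value (`E.le`). -/

namespace RegImpl

/-! ### Executions, solo runs and replacing the state of one process -/

section Executions

variable {m n : ℕ} {A : RegImpl m n}

theorem ExecFrom.append {C C' C'' : A.Config} {h h' : List (Event m n A.r)}
    (h₁ : A.ExecFrom C h C') (h₂ : A.ExecFrom C' h' C'') : A.ExecFrom C (h ++ h') C'' := by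
  induction h₁ with
  | nil => exact h₂
  | cons s _ ih => exact .cons s (ih h₂)

theorem ExecFrom.single {C C' : A.Config} {e : Event m n A.r} (s : A.Step C e C') :
    A.ExecFrom C [e] C' := .cons s (.nil _)

theorem ExecFrom.split {C C'' : A.Config} {h h' : List (Event m n A.r)}
    (H : A.ExecFrom C (h ++ h') C'') : ∃ C', A.ExecFrom C h C' ∧ A.ExecFrom C' h' C'' := by
  induction h generalizing C with
  | nil => exact ⟨C, .nil _, H⟩
  | cons e h ih =>
    cases H with
    | cons s H =>
      obtain ⟨C', h₁, h₂⟩ := ih H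
      exact ⟨C', .cons s h₁, h₂⟩

/-- Steps of other processes leave a process alone. -/
theorem Step.frame {C C' : A.Config} {e : Event m n A.r} (s : A.Step C e C') {q : Proc A.r}
    (hq : e.proc ≠ q) : C'.state q = C.state q ∧ C'.busy q = C.busy q := by
  cases s <;> simp only [Event.proc] at hq <;>
    simp [Function.update_of_ne hq.symm]

theorem ExecFrom.frame {C C' : A.Config} {h : List (Event m n A.r)} (H : A.ExecFrom C h C')
    {q : Proc A.r} (hq : ∀ e ∈ h, e.proc ≠ q) :
    C'.state q = C.state q ∧ C'.busy q = C.busy q := by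
  induction H with
  | nil => exact ⟨rfl, rfl⟩
  | cons s _ ih =>
    have h₁ := s.frame (hq _ (by simp))
    have h₂ := ih fun e he => hq e (by simp [he])
    exact ⟨h₂.1.trans h₁.1, h₂.2.trans h₁.2⟩

/-- A process becomes busy only by an invocation. -/
theorem Step.busy_eq_false {C C' : A.Config} {e : Event m n A.r} (s : A.Step C e C')
    {q : Proc A.r} (hC : C.busy q = false) (he : ∀ a, e ≠ .inv q a) :
    C'.busy q = false ∧ ∀ o, e ≠ .ret q o := by
  cases s with
  | inv q' a hq =>
    have : q ≠ q' := by rintro rfl; exact he a rfl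
    simp [Function.update_of_ne this, hC]
  | physRead q' => exact ⟨hC, by simp⟩
  | physWrite q' => exact ⟨hC, by simp⟩
  | ret q' o s hq =>
    have : q ≠ q' := by rintro rfl; simp [hC] at hq
    refine ⟨by simp [Function.update_of_ne this, hC], fun o' h => ?_⟩
    injection h with h1
    exact this h1.symm

theorem ExecFrom.busy_eq_false {C C' : A.Config} {h : List (Event m n A.r)}
    (H : A.ExecFrom C h C') {q : Proc A.r} (hC : C.busy q = false)
    (hi : ∀ a, .inv q a ∉ h) : C'.busy q = false ∧ ∀ o, .ret q o ∉ h := by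
  induction H with
  | nil => exact ⟨hC, by simp⟩
  | cons s _ ih =>
    have h₁ := s.busy_eq_false hC fun a ha => hi a (by simp [ha])
    have h₂ := ih h₁.1 fun a ha => hi a (by simp [ha])
    exact ⟨h₂.1, fun o ho => (List.mem_cons.1 ho).elim (fun h => h₁.2 o h.symm) (h₂.2 o)⟩

/-- A process stops being busy only by a response. -/
theorem Step.busy_eq_true {C C' : A.Config} {e : Event m n A.r} (s : A.Step C e C')
    {q : Proc A.r} (hC : C.busy q = true) (he : ∀ o, e ≠ .ret q o) : C'.busy q = true := by
  cases s with
  | inv q' a hq =>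
    have : q ≠ q' := by rintro rfl; simp [hC] at hq
    simp [Function.update_of_ne this, hC]
  | physRead q' => exact hC
  | physWrite q' => exact hC
  | ret q' o s hq =>
    have : q ≠ q' := by rintro rfl; exact he o rfl
    simp [Function.update_of_ne this, hC]

theorem ExecFrom.busy_eq_true {C C' : A.Config} {h : List (Event m n A.r)}
    (H : A.ExecFrom C h C') {q : Proc A.r} (hC : C.busy q = true)
    (ho : ∀ o, .ret q o ∉ h) : C'.busy q = true := by
  induction H with
  | nil => exact hC
  | cons s _ ih =>
    exact ih (s.busy_eq_true hC fun o h => ho o (by simp [h])) fun o h => ho o (by simp [h])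

theorem Step.busy_of_inv {C C' : A.Config} {q : Proc A.r} {a : Arg m q}
    (s : A.Step C (.inv q a) C') : C'.busy q = true := by
  cases s; simp

/-- The invocation of an operation in progress. -/
theorem ExecFrom.exists_inv {C C' : A.Config} {h : List (Event m n A.r)}
    (H : A.ExecFrom C h C') {q : Proc A.r} (hC : C.busy q = false) (hC' : C'.busy q = true) :
    ∃ h₁ a h₂, h = h₁ ++ .inv q a :: h₂ ∧ ∀ a', .inv q a' ∉ h₂ := by
  have key : ∀ h : List (Event m n A.r), (∀ a, .inv q a ∉ h) ∨
      ∃ h₁ a h₂, h = h₁ ++ .inv q a :: h₂ ∧ ∀ a', .inv q a' ∉ h₂ := by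
    intro h
    induction h with
    | nil => exact .inl (by simp)
    | cons e h ih =>
      rcases ih with ih | ⟨h₁, a, h₂, rfl, h'⟩
      · by_cases he : ∃ a, e = .inv q a
        · obtain ⟨a, rfl⟩ := he
          exact .inr ⟨[], a, h, rfl, ih⟩
        · push Not at he
          exact .inl fun a ha => (List.mem_cons.1 ha).elim (fun h => he a h.symm) (ih a)
      · exact .inr ⟨e :: h₁, a, h₂, rfl, h'⟩
  rcases key h with h' | h'
  · simp [(H.busy_eq_false hC h').1] at hC'
  · exact h'

/-- An event that neither starts nor ends an operation. -/
def Event.Internal {r : ℕ} : Event m n r → Prop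
  | .inv _ _ => False
  | .ret _ _ => False
  | .physRead _ _ => True
  | .physWrite _ _ => True

/-- The run is cut at the first response of `q`; until then `q` is busy and cannot invoke anything.
-/
theorem ExecFrom.exists_solo {C C' : A.Config} {h : List (Event m n A.r)} {q : Proc A.r}
    (H : A.ExecFrom C h C') (hp : ∀ e ∈ h, e.proc = q) (hC : C.busy q = true)
    (hC' : C'.busy q = false) : ∃ g D o D', A.ExecFrom C g D ∧
      (∀ e ∈ g, e.proc = q ∧ e.Internal) ∧ A.Step D (.ret q o) D' := by
  induction H with
  | nil => simp [hC] at hC'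
  | @cons C C₁ C₂ e h s _ ih =>
    have hq : e.proc = q := hp e (by simp)
    by_cases he : ∃ o, e = .ret q o
    · obtain ⟨o, rfl⟩ := he
      exact ⟨[], C, o, _, .nil _, by simp, s⟩
    · have hi : e.Internal := by
        cases s with
        | inv q' a h => obtain rfl : q' = q := hq; simp [hC] at h
        | ret q' o => obtain rfl : q' = q := hq; exact he ⟨o, rfl⟩
        | physRead => trivial
        | physWrite => trivial
      obtain ⟨g, D, o, D', h₁, h₂, h₃⟩ := ih (fun e he => hp e (by simp [he]))
        (s.busy_eq_true hC fun o h => he ⟨o, h⟩) hC'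
      refine ⟨e :: g, D, o, D', .cons s h₁, ?_, h₃⟩
      intro e' he'
      rcases List.mem_cons.1 he' with rfl | he'
      · exact ⟨hq, hi⟩
      · exact h₂ e' he'

theorem ObstructionFree.exists_solo (hA : A.ObstructionFree) {h : List (Event m n A.r)}
    {C : A.Config} (H : A.Exec h C) {q : Proc A.r} (hC : C.busy q = true) :
    ∃ g D o D', A.ExecFrom C g D ∧ (∀ e ∈ g, e.proc = q ∧ e.Internal) ∧
      A.Step D (.ret q o) D' := by
  obtain ⟨h', C', h₁, h₂, h₃⟩ := hA h C H q
  exact h₁.exists_solo h₂ hC h₃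

theorem not_inv_mem_of_internal {r : ℕ} {g : List (Event m n r)} {q q' : Proc r}
    (hg : ∀ e ∈ g, e.proc = q ∧ e.Internal) (a : Arg m q') : .inv q' a ∉ g :=
  fun h => (hg _ h).2

theorem LastCompleted.eq_or_mem {r : ℕ} {v₀ v : Fin m} {h : List (Event m n r)}
    (H : LastCompleted v₀ h v) :
    (.ret .writer () ∉ h ∧ v = v₀) ∨ .inv .writer v ∈ h := by
  rcases H with H | ⟨h₁, h₂, h₃, rfl, -, -⟩
  · exact .inl H
  · right; simp

theorem PendingWrite.mem {r : ℕ} {v : Fin m} {h : List (Event m n r)}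
    (H : PendingWrite h v) : .inv .writer v ∈ h := by
  obtain ⟨h₁, h₂, rfl, -⟩ := H; simp

/-- A value that is neither initial nor written is not returned. -/
theorem Regular.eq_or_mem (hA : A.Regular) {h : List (Event m n A.r)} {C C' : A.Config}
    (H : A.Exec h C) {j : Fin A.r} {o : Fin m} (s : A.Step C (.ret (.reader j) o) C') :
    o = A.initVal ∨ .inv .writer o ∈ h := by
  have hb : C.busy (.reader j) = true := by cases s; assumption
  obtain ⟨h₁, a, h₂, rfl, hi⟩ := ExecFrom.exists_inv H (q := .reader j) rfl hb
  have H' : A.Exec (h₁ ++ .inv (.reader j) () :: (h₂ ++ [.ret (.reader j) o])) C' := by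
    have := ExecFrom.append H (.single s)
    simpa [Exec] using this
  rcases hA j o h₁ h₂ C' H' (hi ()) with h | h | h
  · rcases h.eq_or_mem with h | h
    · exact .inl h.2
    · right; simp [h]
  · right; simp [h.mem]
  · right; simp [h]

theorem last_occurrence_unique {α : Type*} {P : α → Prop} {l₁ l₂ l₁' l₂' : List α} {x x' : α}
    (h : l₁ ++ x :: l₂ = l₁' ++ x' :: l₂') (hx : P x) (hx' : P x') (h₂ : ∀ y ∈ l₂, ¬ P y)
    (h₂' : ∀ y ∈ l₂', ¬ P y) : l₁ = l₁' ∧ x = x' ∧ l₂ = l₂' := by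
  rcases List.append_eq_append_iff.1 h with ⟨t, rfl, ht⟩ | ⟨t, rfl, ht⟩
  · cases t with
    | nil => simp at ht; simp [ht]
    | cons y t =>
      simp only [List.cons_append, List.cons.injEq] at ht
      exact absurd hx' (h₂ _ (by simp [ht.2]))
  · cases t with
    | nil => simp at ht; simp [ht]
    | cons y t =>
      simp only [List.cons_append, List.cons.injEq] at ht
      exact absurd hx (h₂' _ (by simp [ht.2]))

/-- The last response of the writer has a unique position, and so has the last invocation of the
writer before it. This makes the initial value of a restarted algorithm well determined. -/
theorem LastCompleted.unique {r : ℕ} {v₀ v w : Fin m} {h : List (Event m n r)}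
    (hv : LastCompleted v₀ h v) (hw : LastCompleted v₀ h w) : v = w := by
  rcases hv with ⟨hv, rfl⟩ | ⟨h₁, h₂, h₃, rfl, hi, ho⟩
  · rcases hw with ⟨-, rfl⟩ | ⟨h₁, h₂, h₃, rfl, -, -⟩
    · rfl
    · simp at hv
  · rcases hw with ⟨hw, -⟩ | ⟨h₁', h₂', h₃', he, hi', ho'⟩
    · simp at hw
    · have h₁ := last_occurrence_unique (P := fun e => e = .ret .writer ())
        (l₁ := h₁ ++ .inv .writer v :: h₂) (l₁' := h₁' ++ .inv .writer w :: h₂')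
        (by simpa using he) rfl rfl (by rintro _ h rfl; exact ho h)
        (by rintro _ h rfl; exact ho' h)
      have h₂ := last_occurrence_unique (P := fun e => ∃ u, e = .inv .writer u) h₁.1
        ⟨_, rfl⟩ ⟨_, rfl⟩ (by rintro _ h ⟨u, rfl⟩; exact hi u h)
        (by rintro _ h ⟨u, rfl⟩; exact hi' u h)
      have := h₂.2.1
      injection this

/-- The configuration with the local state and the status of process `q` replaced. -/
def Config.setProc (C : A.Config) (q : Proc A.r) (s : (A.prog q).State) (β : Bool) :
    A.Config where
  mem := C.mem
  state := Function.update C.state q s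
  busy := Function.update C.busy q β

theorem Config.setProc_self (C : A.Config) (q : Proc A.r) :
    C.setProc q (C.state q) (C.busy q) = C := by
  simp [Config.setProc]

/-- A step depends only on the memory and on the state and status of the acting process. -/
theorem Step.setProc {C C' : A.Config} {e : Event m n A.r} (st : A.Step C e C')
    {q : Proc A.r} (hq : e.proc ≠ q) (s : (A.prog q).State) (β : Bool) :
    A.Step (C.setProc q s β) e (C'.setProc q s β) := by
  cases st with
  | inv q' a hb =>
    replace hq : q' ≠ q := hq
    have := Step.inv (C.setProc q s β) q' a (by simpa [Config.setProc, hq] using hb)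
    simpa [Config.setProc, hq, Function.update_comm hq] using this
  | physRead q' i k hb ha =>
    replace hq : q' ≠ q := hq
    have := Step.physRead (C.setProc q s β) q' i k (by simpa [Config.setProc, hq] using hb)
      (by simpa [Config.setProc, hq] using ha)
    simpa [Config.setProc, hq, Function.update_comm hq] using this
  | physWrite q' i x t hb ha =>
    replace hq : q' ≠ q := hq
    have := Step.physWrite (C.setProc q s β) q' i x t
      (by simpa [Config.setProc, hq] using hb) (by simpa [Config.setProc, hq] using ha)
    simpa [Config.setProc, hq, Function.update_comm hq] using this
  | ret q' o t hb ha =>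
    replace hq : q' ≠ q := hq
    have := Step.ret (C.setProc q s β) q' o t
      (by simpa [Config.setProc, hq] using hb) (by simpa [Config.setProc, hq] using ha)
    simpa [Config.setProc, hq, Function.update_comm hq] using this

/-- The steps of a process that does not write can be removed, whatever state it is in. -/
theorem ExecFrom.erase {C C' : A.Config} {h : List (Event m n A.r)} (H : A.ExecFrom C h C')
    {q : Proc A.r} (hw : ∀ i, .physWrite q i ∉ h) (s : (A.prog q).State) (β : Bool) :
    A.ExecFrom (C.setProc q s β) (h.filter (·.proc ≠ q)) (C'.setProc q s β) := by
  induction H with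
  | nil => exact .nil _
  | @cons C C₁ C₂ e h st _ ih =>
    have ih := ih fun i hi => hw i (by simp [hi])
    by_cases he : e.proc = q
    -- A step of `q` that is not a write changes only the data of `q`, which `setProc` overwrites.
    · have : C₁.setProc q s β = C.setProc q s β := by
        cases st with
        | physWrite q' i => obtain rfl : q' = q := he; exact absurd (by simp) (hw i)
        | inv q' | physRead q' | ret q' =>
          obtain rfl : q' = q := he; simp [Config.setProc]
      rw [this] at ih
      simpa [he] using ih
    · rw [List.filter_cons_of_pos (by simpa using he)]
      exact .cons (st.setProc he s β) ih

theorem ExecFrom.setProc {C C' : A.Config} {h : List (Event m n A.r)} (H : A.ExecFrom C h C')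
    {q : Proc A.r} (hq : ∀ e ∈ h, e.proc ≠ q) (s : (A.prog q).State) (β : Bool) :
    A.ExecFrom (C.setProc q s β) h (C'.setProc q s β) := by
  have := H.erase (fun i hi => hq _ hi rfl) s β
  rwa [List.filter_eq_self.2 (by simpa using hq)] at this

end Executions

/-! ### Replaying the invisible reader, and the value that becomes unreachable -/

section Replay

variable {m n : ℕ} {A : RegImpl m n}

/-- `h` contains no write of `v` and no event of reader `j`. -/
def Avoids (A : RegImpl m n) (v : Fin m) (j : Fin A.r) (h : List (Event m n A.r)) : Prop :=
  .inv .writer v ∉ h ∧ ∀ e ∈ h, e.proc ≠ .reader j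

theorem Avoids.append {v : Fin m} {j : Fin A.r} {h h' : List (Event m n A.r)}
    (H : A.Avoids v j h) (H' : A.Avoids v j h') : A.Avoids v j (h ++ h') :=
  ⟨by simp [H.1, H'.1], fun e he => (List.mem_append.1 he).elim (H.2 e) (H'.2 e)⟩

/-- If the other processes can always give every value to every register without writing `v`,
then they can make the invisible reader `j` take the same steps as in any other execution. -/
theorem replay {v : Fin m} {j : Fin A.r} (hinv : A.Invisible j)
    (hdrive : ∀ h C, A.Exec h C → A.Avoids v j h → ∀ i x,
      ∃ h' C', A.ExecFrom C h' C' ∧ A.Avoids v j h' ∧ C'.mem i = x)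
    {D D' : A.Config} {g : List (Event m n A.r)} (H : A.ExecFrom D g D')
    (hg : ∀ e ∈ g, e.proc = .reader j ∧ e.Internal) :
    ∀ g₀, A.Exec g₀ D → ∀ (h : List (Event m n A.r)) (K : A.Config), A.Exec h K →
      A.Avoids v j h → D.busy (.reader j) = true → ∃ h' h'' K', A.Exec h' K' ∧ A.Avoids v j h' ∧
        A.ExecFrom (K.setProc (.reader j) (D.state _) true) h''
          (K'.setProc (.reader j) (D'.state _) true) ∧ .inv .writer v ∉ h'' := by
  induction H with
  | nil D => intro _ _ h K hK hav _; exact ⟨h, [], K, hK, hav, .nil _, by simp⟩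
  | @cons D D₁ D₂ e g st _ ih =>
    intro g₀ hD h K hK hav hb
    have he := hg e (by simp)
    have ih := ih (fun e he => hg e (by simp [he])) (g₀ ++ [e]) (hD.append (.single st))
    cases st with
    | inv => exact he.2.elim
    | ret => exact he.2.elim
    | physWrite q i =>
      obtain rfl : q = .reader j := he.1
      -- The prefix `g₀` serves only here: it makes `D` reachable, so that invisibility rules out a
      -- write.
      exact absurd (by simp) (hinv _ _ (hD.append (.single (.physWrite D _ i _ _ hb ‹_›))) i)
    | physRead q i k _ ha =>
      obtain rfl : q = .reader j := he.1
      -- The driving happens in an execution where `j` has not moved at all; the state of `j` is put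
      -- on top of it afterwards by `setProc`.
      obtain ⟨h₁, K₁, H₁, av₁, hm⟩ := hdrive h K hK hav i (D.mem i)
      obtain ⟨h', h'', K', E', av', E'', hv⟩ := ih (h ++ h₁) K₁ (hK.append H₁) (hav.append av₁) hb
      refine ⟨h', h₁ ++ .physRead (.reader j) i :: h'', K', E', av', ?_, by simp [av₁.1, hv]⟩
      refine (H₁.setProc av₁.2 (D.state _) true).append (.cons ?_ E'')
      have := Step.physRead (K₁.setProc (.reader j) (D.state _) true) (.reader j) i k
        (by simp [Config.setProc]) (by simpa [Config.setProc] using ha)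
      simpa [Config.setProc, hm] using this

/-- There is a reachable configuration from which some register can no longer take some value
unless `v` is written. -/
theorem exists_unreachable_value {v : Fin m} {j : Fin A.r} (hreg : A.Regular)
    (hof : A.ObstructionFree) (hinv : A.Invisible j) (hv : v ≠ A.initVal) :
    ∃ h C, A.Exec h C ∧ A.Avoids v j h ∧ ∃ i x, ∀ h' C', A.ExecFrom C h' C' →
      A.Avoids v j h' → C'.mem i ≠ x := by
  by_contra hcon
  push Not at hcon
  -- a solo write of `v`
  have W₀ := Step.inv A.initConfig .writer v rfl
  obtain ⟨g, D, o, D', W₁, hg, W₂⟩ := hof.exists_solo (ExecFrom.single W₀)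
    (q := .writer) (by simp)
  have W : A.Exec (.inv .writer v :: (g ++ [.ret .writer o])) D' :=
    .cons W₀ (W₁.append (.single W₂))
  have hj : ∀ e ∈ (.inv .writer v :: (g ++ [.ret .writer o]) : List (Event m n A.r)),
      e.proc ≠ .reader j := by
    intro e he
    simp only [List.mem_cons, List.mem_append, List.not_mem_nil, or_false] at he
    rcases he with rfl | he | rfl
    · simp [Event.proc]
    · simp [(hg e he).1]
    · simp [Event.proc]
  have hfr := ExecFrom.frame W hj
  -- followed by a solo read
  have R₀ := Step.inv D' (.reader j) () hfr.2
  obtain ⟨g', F, w, F', R₁, hg', R₂⟩ := hof.exists_solo (W.append (.single R₀))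
    (q := .reader j) (by simp)
  -- The only write in this run is the completed write of `v`.
  have hw : w = v := by
    have R := W.append (.cons R₀ (R₁.append (.single R₂)))
    rcases hreg j w _ g' F' R (not_inv_mem_of_internal hg' _) with h | h | h
    · rcases h.eq_or_mem with h | h
      · simp at h
      · simpa [not_inv_mem_of_internal hg] using h
    · simpa [not_inv_mem_of_internal hg] using h.mem
    · exact absurd h (not_inv_mem_of_internal hg' _)
  subst hw
  -- the same read without a write of `v`
  obtain ⟨h', h'', K', -, -, E'', hv''⟩ := replay hinv hcon R₁ hg' _ (W.append (.single R₀)) []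
    A.initConfig (.nil _) ⟨by simp, by simp⟩ (by simp)
  have R₀' := Step.inv A.initConfig (.reader j) () rfl
  have R₃ : A.Step (K'.setProc (.reader j) (F.state _) true) (.ret (.reader j) w)
      (K'.setProc (.reader j) (F'.state _) false) := by
    cases R₂ with
    | ret _ _ s hb ha =>
      have := Step.ret (K'.setProc (.reader j) (F.state _) true) (.reader j) w s
        (by simp [Config.setProc]) (by simpa [Config.setProc] using ha)
      simpa [Config.setProc] using this
  have E₀ : A.Exec (.inv (.reader j) () :: h'') (K'.setProc (.reader j) (F.state _) true) := by
    refine .cons R₀' ?_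
    -- The solo write left `j` in its initial state, so the replayed read may begin in the initial
    -- configuration.
    have h0 : D'.state (.reader j) = (A.prog (.reader j)).init := hfr.1
    simpa [Config.setProc, h0, initConfig] using E''
  rcases hreg.eq_or_mem E₀ R₃ with h | h
  · exact hv h
  · simp [hv''] at h

/-- Pending operations are finished one at a time. A solo run up to the response contains no
invocation, so `v` is not written and idle processes stay idle. -/
theorem ObstructionFree.exists_idle {v : Fin m} {j : Fin A.r} (hof : A.ObstructionFree)
    {h : List (Event m n A.r)} {C : A.Config} (H : A.Exec h C) (hav : A.Avoids v j h)
    (l : List (Proc A.r)) :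
    ∃ h' C', A.ExecFrom C h' C' ∧ A.Avoids v j h' ∧ ∀ q ∈ l, C'.busy q = false := by
  induction l with
  | nil => exact ⟨[], C, .nil _, ⟨by simp, by simp⟩, by simp⟩
  | cons q l ih =>
    obtain ⟨h', C', H', hav', hl⟩ := ih
    rcases hb : C'.busy q with _ | _
    · exact ⟨h', C', H', hav', by simpa [hb] using hl⟩
    · obtain ⟨g, D, o, D', S₁, hg, S₂⟩ := hof.exists_solo (H.append H') hb
      -- Reader `j` has had no event, hence is still idle.
      have hqj : q ≠ .reader j := by
        rintro rfl
        have := (ExecFrom.frame (H.append H') (hav.append hav').2).2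
        rw [hb] at this
        simp [initConfig] at this
      refine ⟨h' ++ (g ++ [.ret q o]), D', H'.append (S₁.append (.single S₂)),
        hav'.append (.append ⟨not_inv_mem_of_internal hg _, fun e he => ?_⟩ ⟨by simp, ?_⟩), ?_⟩
      · rw [(hg e he).1]; exact hqj
      · simpa [Event.proc] using hqj
      · intro q' hq'
        by_cases hqq : q' = q
        · subst hqq; cases S₂; simp
        · have hq' : q' ∈ l := by simpa [hqq] using hq'
          exact (S₂.busy_eq_false ((S₁.busy_eq_false (hl q' hq')
            (not_inv_mem_of_internal hg)).1) (by simp)).1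

end Replay

/-! ### Restarting an algorithm with fewer values -/

section Restrict

variable {m m' n : ℕ}

/-- Translation of the values that registers hold and of responses. -/
def Action.map {b b' : Fin n → ℕ} {out out' σ : Type} (e : ∀ i, Fin (b' i) → Fin (b i))
    (p : ∀ i, Fin (b i) → Fin (b' i)) (f : out → out') : Action b out σ → Action b' out' σ
  | .read i k => .read i fun y => k (e i y)
  | .write i x s => .write i (p i x) s
  | .ret o s => .ret (f o) s

/-- The function on arguments induced by a function on register values. -/
def mapArg (f : Fin m' → Fin m) {r : ℕ} : ∀ q : Proc r, Arg m' q → Arg m q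
  | .writer, a => f a
  | .reader _, a => a

/-- The function on responses induced by a function on register values. -/
def mapResp (f : Fin m' → Fin m) {r : ℕ} : ∀ q : Proc r, Resp m' q → Resp m q
  | .writer, o => o
  | .reader _, o => f o

/-- The function on events induced by a function on register values. -/
def Event.map (f : Fin m' → Fin m) {r : ℕ} : Event m' n r → Event m n r
  | .inv q a => .inv q (mapArg f q a)
  | .ret q o => .ret q (mapResp f q o)
  | .physRead q i => .physRead q i
  | .physWrite q i => .physWrite q i

/-- The algorithm `A` started in the idle configuration `C`, with the simulated and physical
registers restricted to fewer values. -/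
def restrict (A : RegImpl m n) {b' : Fin n → ℕ} (e : ∀ i, Fin (b' i) → Fin (A.b i))
    (p : ∀ i, Fin (A.b i) → Fin (b' i)) (f : Fin m' → Fin m) (g : Fin m → Fin m')
    (v₀ : Fin m') (C : A.Config) : RegImpl m' n where
  r := A.r
  b := b'
  initVal := v₀
  initMem i := p i (C.mem i)
  prog q :=
    { State := (A.prog q).State
      init := C.state q
      invoke := fun a => (A.prog q).invoke (mapArg f q a)
      act := fun s => ((A.prog q).act s).map e p (mapResp g q) }

variable {A : RegImpl m n} {b' : Fin n → ℕ} {e : ∀ i, Fin (b' i) → Fin (A.b i)}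
  {p : ∀ i, Fin (A.b i) → Fin (b' i)} {f : Fin m' → Fin m} {g : Fin m → Fin m'}
  {v₀ : Fin m'} {C : A.Config}

/-- The configuration of `A` that a configuration of the restricted algorithm stands for. -/
def embed (D : (A.restrict e p f g v₀ C).Config) : A.Config where
  mem := fun i => e i (D.mem i)
  state := D.state
  busy := D.busy

/-- `D` is reached from `C` without writing a value outside the range of `f`. -/
def ReachIn (f : Fin m' → Fin m) (C D : A.Config) : Prop :=
  ∃ h, A.ExecFrom C h D ∧ ∀ w, .inv .writer w ∈ h → w ∈ Set.range f

theorem ReachIn.step {D D' : A.Config} (H : ReachIn f C D) {ev : Event m n A.r}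
    (s : A.Step D ev D') (hev : ∀ w, ev = .inv .writer w → w ∈ Set.range f) :
    ReachIn f C D' := by
  obtain ⟨h, H, hw⟩ := H
  refine ⟨h ++ [ev], H.append (.single s), fun w hmem => ?_⟩
  rcases List.mem_append.1 hmem with h | h
  · exact hw w h
  · exact hev w (List.mem_singleton.1 h).symm

/-- In the reachable configurations the restrictions do not lose any values. -/
structure Lossless (e : ∀ i, Fin (b' i) → Fin (A.b i)) (p : ∀ i, Fin (A.b i) → Fin (b' i))
    (f : Fin m' → Fin m) (g : Fin m → Fin m') (C : A.Config) : Prop where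
  mem : ∀ D, ReachIn f C D → ∀ i, e i (p i (D.mem i)) = D.mem i
  ret : ∀ D, ReachIn f C D → ∀ j o D', A.Step D (.ret (.reader j) o) D' → f (g o) = o

theorem map_inv_mem_range {r : ℕ} {ev : Event m' n r} {w : Fin m}
    (h : ev.map f = .inv .writer w) : w ∈ Set.range f := by
  cases ev with
  | inv q a =>
    cases q with
    | writer =>
      simp only [Event.map, mapArg] at h
      injection h with h1 h2
      exact ⟨a, h2⟩
    | reader i => simp [Event.map] at h
  | _ => simp [Event.map] at h

theorem embed_update {D : (A.restrict e p f g v₀ C).Config} {i : Fin n} {x : Fin (A.b i)}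
    (hx : e i (p i x) = x) (s : ∀ q, ((A.restrict e p f g v₀ C).prog q).State)
    (β : Proc A.r → Bool) :
    embed (⟨Function.update D.mem i (p i x), s, β⟩ : (A.restrict e p f g v₀ C).Config) =
      ⟨Function.update (embed D).mem i x, s, β⟩ := by
  refine congrArg (fun M => (⟨M, s, β⟩ : A.Config)) (funext fun k => ?_)
  by_cases hk : k = i
  · subst hk
    exact (congrArg _ (Function.update_self ..)).trans 
      (hx.trans (Function.update_self k x (embed D).mem).symm)
  · have h : Function.update (embed D).mem i x k = e k (D.mem k) :=
      Function.update_of_ne hk x (embed D).mem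
    exact (congrArg _ (Function.update_of_ne hk ..)).trans h.symm

/-- Forward simulation: it carries safety properties of `A` over to the restricted algorithm. -/
theorem Lossless.step (hL : Lossless e p f g C) {D D' : (A.restrict e p f g v₀ C).Config}
    {ev : Event m' n (A.restrict e p f g v₀ C).r}
    (s : (A.restrict e p f g v₀ C).Step D ev D')
    (hD : ReachIn f C (embed D)) : A.Step (embed D) (ev.map f) (embed D') := by
  cases s with
  | inv q a hq => exact Step.inv (embed D) q (mapArg f q a) hq
  | physRead q i k hq ha =>
    have ha : ((A.prog q).act (D.state q)).map e p (mapResp g q) = .read i k := ha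
    rcases hact : (A.prog q).act (D.state q) with ⟨i', k'⟩ | ⟨i', x', s'⟩ | ⟨o', s'⟩ <;>
      rw [hact] at ha <;> simp only [Action.map] at ha <;> cases ha
    exact Step.physRead (embed D) q i k' hq hact
  | physWrite q i x s hq ha =>
    have ha : ((A.prog q).act (D.state q)).map e p (mapResp g q) = .write i x s := ha
    rcases hact : (A.prog q).act (D.state q) with ⟨i', k'⟩ | ⟨i', x', s'⟩ | ⟨o', s'⟩ <;>
      rw [hact] at ha <;> simp only [Action.map] at ha <;> cases ha
    have st := Step.physWrite (embed D) q i x' s hq hact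
    -- Losslessness is applied after the write, when the written value is itself the content of
    -- register `i`.
    have hm := hL.mem _ (hD.step st (by simp)) i
    simp only [Function.update_self] at hm
    exact (congrArg (A.Step (embed D) (.physWrite q i)) (embed_update hm _ _)).mpr st
  | ret q o s hq ha =>
    have ha : ((A.prog q).act (D.state q)).map e p (mapResp g q) = .ret o s := ha
    rcases hact : (A.prog q).act (D.state q) with ⟨i', k'⟩ | ⟨i', x', s'⟩ | ⟨o', s'⟩ <;>
      rw [hact] at ha <;> simp only [Action.map] at ha <;> cases ha
    have st := Step.ret (embed D) q o' s hq hact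
    have : mapResp f q (mapResp g q o') = o' := by
      cases q with
      | writer => rfl
      | reader j => exact hL.ret _ hD j o' _ st
    rw [Event.map, this]
    exact st

theorem Lossless.execFrom (hL : Lossless e p f g C) {D D' : (A.restrict e p f g v₀ C).Config}
    {h : List (Event m' n (A.restrict e p f g v₀ C).r)}
    (H : (A.restrict e p f g v₀ C).ExecFrom D h D')
    (hD : ReachIn f C (embed D)) :
    A.ExecFrom (embed D) (h.map (Event.map f)) (embed D') ∧ ReachIn f C (embed D') := by
  induction H with
  | nil => exact ⟨.nil _, hD⟩
  | cons s _ ih =>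
    have st := hL.step s hD
    have := ih (hD.step st fun w hw => map_inv_mem_range hw)
    exact ⟨.cons st this.1, this.2⟩

theorem Lossless.exec (hL : Lossless e p f g C) (hC : ∀ q, C.busy q = false)
    {D : (A.restrict e p f g v₀ C).Config} {h : List (Event m' n A.r)}
    (H : (A.restrict e p f g v₀ C).Exec h D) :
    A.ExecFrom C (h.map (Event.map f)) (embed D) ∧ ReachIn f C (embed D) := by
  have hR : ReachIn f C C := ⟨[], .nil _, by simp⟩
  have h₀ : embed (A.restrict e p f g v₀ C).initConfig = C := by
    have h₁ := hL.mem C hR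
    calc embed (A.restrict e p f g v₀ C).initConfig
        = ⟨fun i => e i (p i (C.mem i)), C.state, fun _ => false⟩ := rfl
      _ = C := by rw [funext h₁, ← funext hC]
  have := hL.execFrom H (by rw [h₀]; exact hR)
  rwa [h₀] at this

/-- Backward simulation, needed to transfer obstruction-freedom. Invocations are excluded because
`A` may be asked to write a value outside the range of `f`. -/
theorem Lossless.step_back (hL : Lossless e p f g C) {D : (A.restrict e p f g v₀ C).Config}
    (hD : ReachIn f C (embed D)) {ev : Event m n A.r} {F : A.Config}
    (s : A.Step (embed D) ev F) (hev : ∀ q a, ev ≠ .inv q a) :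
    ∃ (ev' : Event m' n A.r) (D' : (A.restrict e p f g v₀ C).Config),
      (A.restrict e p f g v₀ C).Step D ev' D' ∧ ev'.proc = ev.proc ∧ embed D' = F := by
  cases s with
  | inv q a => exact absurd rfl (hev q a)
  | physRead q i k hq ha =>
    have ha : (A.prog q).act (D.state q) = .read i k := ha
    exact ⟨.physRead q i, _, .physRead D q i (fun y => k (e i y)) hq
      (by simp [restrict, ha, Action.map]), rfl, rfl⟩
  | physWrite q i x s hq ha =>
    have st := Step.physWrite (embed D) q i x s hq ha
    have ha : (A.prog q).act (D.state q) = .write i x s := ha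
    have st' := Step.physWrite D q i (p i x) s hq (by simp [restrict, ha, Action.map])
    have hm := hL.mem _ (hD.step st (by simp)) i
    simp only [Function.update_self] at hm
    exact ⟨.physWrite q i, _, st', rfl, embed_update hm _ _⟩
  | ret q o s hq ha =>
    have ha : (A.prog q).act (D.state q) = .ret o s := ha
    exact ⟨.ret q (mapResp g q o), _, .ret D q _ s hq (by simp [restrict, ha, Action.map]),
      rfl, rfl⟩

theorem Lossless.execFrom_back (hL : Lossless e p f g C) {F₀ F : A.Config}
    {h : List (Event m n A.r)} {q : Proc A.r} (H : A.ExecFrom F₀ h F)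
    (hh : ∀ ev ∈ h, ev.proc = q ∧ ∀ q a, ev ≠ .inv q a)
    {D : (A.restrict e p f g v₀ C).Config} (hD : ReachIn f C (embed D)) (hF : embed D = F₀) :
    ∃ (h' : List (Event m' n A.r)) (D' : (A.restrict e p f g v₀ C).Config),
      (A.restrict e p f g v₀ C).ExecFrom D h' D' ∧ (∀ ev ∈ h', ev.proc = q) ∧ embed D' = F := by
  induction H generalizing D with
  | nil => exact ⟨[], D, .nil _, by simp, hF⟩
  | @cons F₀ F₁ F₂ ev h s _ ih =>
    subst hF
    have hev := hh ev (by simp)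
    obtain ⟨ev', D₁, s', hp, rfl⟩ := hL.step_back hD s hev.2
    obtain ⟨h', D', H', hq, hF⟩ := ih (fun e he => hh e (by simp [he]))
      (hD.step s fun w hw => absurd hw (hev.2 _ _)) rfl
    exact ⟨ev' :: h', D', .cons s' H', by simpa [hp, hev.1] using hq, hF⟩

variable {h₀ : List (Event m n A.r)}

theorem Lossless.singleWriter (hL : Lossless e p f g C) (hC : ∀ q, C.busy q = false)
    (hh : A.Exec h₀ C) (hA : A.SingleWriter) : (A.restrict e p f g v₀ C).SingleWriter := by
  intro i
  obtain ⟨w, hw⟩ := hA i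
  refine ⟨w, fun h D H q hq => hw _ _ (hh.append (hL.exec hC H).1) q ?_⟩
  exact List.mem_append_right _ (List.mem_map.2 ⟨_, hq, rfl⟩)

theorem Lossless.invisible (hL : Lossless e p f g C) (hC : ∀ q, C.busy q = false)
    (hh : A.Exec h₀ C) {j : Fin A.r} (hA : A.Invisible j) :
    (A.restrict e p f g v₀ C).Invisible j := by
  intro h D H i hi
  exact hA _ _ (hh.append (hL.exec hC H).1) i
    (List.mem_append_right _ (List.mem_map.2 ⟨_, hi, rfl⟩))

theorem Lossless.obstructionFree (hL : Lossless e p f g C) (hC : ∀ q, C.busy q = false)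
    (hh : A.Exec h₀ C) (hA : A.ObstructionFree) :
    (A.restrict e p f g v₀ C).ObstructionFree := by
  intro h D H q
  have hD := hL.exec hC H
  rcases hb : D.busy q with _ | _
  · exact ⟨[], D, .nil _, by simp, hb⟩
  · obtain ⟨k, F, o, F', S₁, hk, S₂⟩ := hA.exists_solo (hh.append hD.1) (q := q) hb
    obtain ⟨h', D', H', hq, hF⟩ := hL.execFrom_back (S₁.append (.single S₂)) (q := q)
      (by
        intro ev hev
        rcases List.mem_append.1 hev with hev | hev
        · refine ⟨(hk ev hev).1, ?_⟩
          rintro q a rfl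
          exact (hk _ hev).2
        · obtain rfl := List.mem_singleton.1 hev
          exact ⟨rfl, by simp⟩) hD.2 rfl
    refine ⟨h', D', H', hq, ?_⟩
    have : F'.busy q = false := by
      cases S₂
      exact Function.update_self q false F.busy
    rw [← hF] at this
    exact this

theorem map_eq_inv_iff (hf : Function.Injective f) {r : ℕ} {ev : Event m' n r} {w : Fin m'} :
    ev.map f = .inv .writer (f w) ↔ ev = .inv .writer w := by
  refine ⟨fun h => ?_, by rintro rfl; rfl⟩
  cases ev with
  | inv q a =>
    cases q with
    | writer =>
      simp only [Event.map, mapArg] at h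
      injection h with h1 h2
      rw [hf h2]
    | reader i => simp [Event.map] at h
  | _ => simp [Event.map] at h

theorem map_eq_ret_iff {r : ℕ} {ev : Event m' n r} :
    ev.map f = .ret .writer () ↔ ev = .ret .writer () := by
  refine ⟨fun h => ?_, by rintro rfl; rfl⟩
  cases ev with
  | ret q a =>
    cases q with
    | writer => rfl
    | reader i => simp [Event.map] at h
  | _ => simp [Event.map] at h

theorem inv_mem_map_iff (hf : Function.Injective f) {r : ℕ} {h : List (Event m' n r)}
    {w : Fin m'} : .inv .writer (f w) ∈ h.map (Event.map f) ↔ .inv .writer w ∈ h := by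
  simp [List.mem_map, map_eq_inv_iff hf]

theorem ret_mem_map_iff {r : ℕ} {h : List (Event m' n r)} :
    .ret .writer () ∈ h.map (Event.map f) ↔ .ret .writer () ∈ h := by
  simp [List.mem_map, map_eq_ret_iff]

theorem pendingWrite_of_map (hf : Function.Injective f) {r : ℕ} {h : List (Event m' n r)}
    {w : Fin m'} (H : PendingWrite (h.map (Event.map f)) (f w)) : PendingWrite h w := by
  obtain ⟨k₁, k₂, hk, ho⟩ := H
  obtain ⟨l₁, l₂, rfl, rfl, hl⟩ := List.map_eq_append_iff.1 hk
  obtain ⟨ev, l₃, rfl, hev, rfl⟩ := List.map_eq_cons_iff.1 hl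
  obtain rfl := (map_eq_inv_iff hf).1 hev
  exact ⟨l₁, l₃, rfl, fun h => ho (ret_mem_map_iff.2 h)⟩

theorem lastCompleted_of_map (hf : Function.Injective f) {r : ℕ} {h : List (Event m' n r)}
    {k₁ k₂ k₃ : List (Event m n r)} {w : Fin m'}
    (hk : h.map (Event.map f) = k₁ ++ .inv .writer (f w) :: (k₂ ++ .ret .writer () :: k₃))
    (hi : ∀ u, .inv .writer u ∉ k₂) (ho : .ret .writer () ∉ k₃) : LastCompleted v₀ h w := by
  obtain ⟨l₁, l₂, rfl, rfl, hl⟩ := List.map_eq_append_iff.1 hk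
  obtain ⟨ev, l₃, rfl, hev, hl₃⟩ := List.map_eq_cons_iff.1 hl
  obtain rfl := (map_eq_inv_iff hf).1 hev
  obtain ⟨l₄, l₅, rfl, rfl, hl₅⟩ := List.map_eq_append_iff.1 hl₃
  obtain ⟨ev, l₆, rfl, hev, rfl⟩ := List.map_eq_cons_iff.1 hl₅
  obtain rfl := map_eq_ret_iff.1 hev
  exact .inr ⟨l₁, l₄, l₆, rfl, fun u hu => hi _ ((inv_mem_map_iff hf).2 hu),
    fun h => ho (ret_mem_map_iff.2 h)⟩

/-- A write that precedes an idle configuration is not pending. -/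
theorem ExecFrom.ret_mem_of_idle {C₀ D : A.Config} {h k : List (Event m n A.r)} {w : Fin m}
    (H : A.ExecFrom C₀ (h ++ .inv .writer w :: k) D) (hD : D.busy .writer = false) :
    .ret .writer () ∈ k := by
  obtain ⟨F, -, H⟩ := H.split
  cases H with
  | cons s H =>
    by_contra hk
    have := H.busy_eq_true s.busy_of_inv fun o ho => hk ho
    simp [hD] at this

/-- Regularity of `A` is applied to `h₀` followed by the translated execution. As `C` is idle, no
write straddles the boundary: a write from `h₀` is completed in `h₀`, and the last such write is
accounted for by `v₀`. -/
theorem Lossless.regular (hL : Lossless e p f g C) (hC : ∀ q, C.busy q = false)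
    (hh : A.Exec h₀ C) (hf : Function.Injective f)
    (hv₀ : ∀ w, LastCompleted A.initVal h₀ (f w) → w = v₀) (hA : A.Regular) :
    (A.restrict e p f g v₀ C).Regular := by
  intro j w (h₁ : List (Event m' n A.r)) (h₂ : List (Event m' n A.r)) D H hi
  have H₁ : A.ExecFrom C ((h₁ ++ (.inv (.reader j) () :: (h₂ ++ [.ret (.reader j) w])) :
      List (Event m' n A.r)).map (Event.map f)) (embed D) := (hL.exec hC H).1
  have HA : A.Exec ((h₀ ++ h₁.map (Event.map f)) ++ .inv (.reader j) () ::
      (h₂.map (Event.map f) ++ [.ret (.reader j) (f w)])) (embed D) := by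
    have := hh.append H₁
    simpa [Exec, Event.map, mapArg, mapResp] using this
  have hi' : .inv (.reader j) () ∉ h₂.map (Event.map f) := by
    intro h
    obtain ⟨ev, hev, he⟩ := List.mem_map.1 h
    cases ev with
    | inv q a =>
      injection he with h1 h2
      subst h1
      exact hi hev
    | _ => simp [Event.map] at he
  obtain ⟨F, H₂, -⟩ := ExecFrom.split (h := h₁.map (Event.map f)) (by simpa using H₁)
  rcases hA j (f w) _ _ _ HA hi' with h | h | h
  · left
    rcases h with ⟨ho, hw⟩ | ⟨k₁, k₂, k₃, hk, hki, hko⟩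
    · simp only [List.mem_append, ret_mem_map_iff, not_or] at ho
      exact .inl ⟨ho.2, hv₀ w (.inl ⟨ho.1, hw⟩)⟩
    · rcases List.append_eq_append_iff.1 hk with ⟨t, rfl, ht⟩ | ⟨t, rfl, ht⟩
      · exact lastCompleted_of_map hf ht hki hko
      · cases t with
        | nil => exact lastCompleted_of_map (k₁ := []) hf ht.symm hki hko
        | cons y t =>
          simp only [List.cons_append, List.cons.injEq] at ht
          obtain ⟨rfl, ht⟩ := ht
          -- A write invoked in `h₀` cannot get its response after `C`, where the writer is idle.
          have hno : ∀ s, h₁.map (Event.map f) = s ++ .ret .writer () :: k₃ →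
              (∀ u, .inv .writer u ∉ s) → False := by
            intro s hs hsi
            rw [hs] at H₂
            obtain ⟨G, H₃, -⟩ := ExecFrom.split (h := s ++ [.ret .writer ()]) (h' := k₃)
              (by simpa using H₂)
            exact (H₃.busy_eq_false (hC .writer) (by simpa using hsi)).2 () (by simp)
          rcases List.append_eq_append_iff.1 ht with ⟨s, rfl, hs⟩ | ⟨s, rfl, hs⟩
          · cases s with
            | nil => exact (hno [] hs.symm (by simp)).elim
            | cons z s =>
              simp only [List.cons_append, List.cons.injEq] at hs
              obtain ⟨rfl, rfl⟩ := hs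
              simp only [List.mem_append, ret_mem_map_iff, not_or] at hko
              exact .inl ⟨hko.2, hv₀ w (.inr ⟨k₁, k₂, s, rfl, hki, hko.1⟩)⟩
          · exact (hno s hs fun u hu => hki u (List.mem_append_right _ hu)).elim
  · right; left
    obtain ⟨k₁, k₂, hk, hko⟩ := h
    rcases List.append_eq_append_iff.1 hk with ⟨t, rfl, ht⟩ | ⟨t, rfl, ht⟩
    · exact pendingWrite_of_map hf ⟨t, k₂, ht, hko⟩
    · cases t with
      | nil => exact pendingWrite_of_map hf ⟨[], k₂, ht.symm, hko⟩
      | cons y t =>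
        simp only [List.cons_append, List.cons.injEq] at ht
        obtain ⟨rfl, rfl⟩ := ht
        exact absurd (List.mem_append_left _ (ExecFrom.ret_mem_of_idle hh (hC _))) hko
  · exact .inr (.inr ((inv_mem_map_iff hf).1 h))

end Restrict

/-! ### Removing one value, and the induction -/

theorem E.pred {m n S : ℕ} (hm : 1 ≤ m) (H : E (m + 1) n S) : 1 ≤ S ∧ E m n (S - 1) := by
  classical
  obtain ⟨A, hsw, hreg, hof, ⟨j, hinv⟩, rfl⟩ := H
  have : Nontrivial (Fin (m + 1)) := Fin.nontrivial_iff_two_le.2 (by omega)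
  have : Nonempty (Fin m) := ⟨⟨0, hm⟩⟩
  obtain ⟨v, hv⟩ := exists_ne A.initVal
  obtain ⟨h₁, C₁, H₁, av₁, i, x, hx⟩ := exists_unreachable_value hreg hof hinv hv
  obtain ⟨h₂, C, H₂, av₂, hidle⟩ := hof.exists_idle H₁ av₁
    (.writer :: (List.finRange A.r).map .reader)
  have hC : ∀ q, C.busy q = false := fun q => hidle q (by cases q <;> simp)
  have hmem : ∀ D, ReachIn v.succAbove C D → D.mem i ≠ x := by
    rintro D ⟨h, H, hh⟩
    have hw : .inv .writer v ∉ h := fun hmem => by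
      obtain ⟨u, hu⟩ := hh v hmem
      exact Fin.succAbove_ne v u hu
    -- Unreachability of `x` is known only for executions without `j`; erasing the invisible `j`
    -- leaves the memory unchanged.
    have H' := H.erase (q := .reader j)
      (fun k hk => hinv _ _ ((H₁.append H₂).append H) k (List.mem_append_right _ hk))
      (C.state (.reader j)) (C.busy (.reader j))
    rw [Config.setProc_self] at H'
    have av : A.Avoids v j (h.filter (·.proc ≠ .reader j)) := by
      refine ⟨?_, fun e he => by simpa using (List.mem_filter.1 he).2⟩
      exact fun hmem => hw (List.mem_filter.1 hmem).1
    have := hx _ _ (H₂.append H') (av₂.append av)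
    exact this
  -- Deleting the single point `⟨i, x⟩` from the sigma type treats all registers uniformly and makes
  -- the new total fanout a cardinality of a complement.
  let T : Fin n → Type := fun k => {y : Fin (A.b k) // (⟨k, y⟩ : Σ k, Fin (A.b k)) ≠ ⟨i, x⟩}
  let eqv : ∀ k, T k ≃ Fin (Fintype.card (T k)) := fun k => Fintype.equivFin _
  have good : ∀ D, ReachIn v.succAbove C D → ∀ k,
      (⟨k, D.mem k⟩ : Σ k, Fin (A.b k)) ≠ ⟨i, x⟩ := by
    intro D hD k h
    obtain rfl : k = i := congrArg Sigma.fst h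
    exact hmem D hD (eq_of_heq (Sigma.mk.inj h).2)
  -- A default image for the deleted value `x`, which is never written in the executions considered.
  let pt : ∀ k, T k := fun k => ⟨C.mem k, good C ⟨[], .nil _, by simp⟩ k⟩
  let e : ∀ k, Fin (Fintype.card (T k)) → Fin (A.b k) := fun k z => ((eqv k).symm z).1
  let p : ∀ k, Fin (A.b k) → Fin (Fintype.card (T k)) := fun k y =>
    if h : (⟨k, y⟩ : Σ k, Fin (A.b k)) ≠ ⟨i, x⟩ then eqv k ⟨y, h⟩ else eqv k (pt k)
  let g : Fin (m + 1) → Fin m := Function.invFun v.succAbove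
  have hg : ∀ w, w ≠ v → v.succAbove (g w) = w := fun w hw =>
    Function.invFun_eq (Fin.exists_succAbove_eq hw)
  have hL : Lossless e p v.succAbove g C := by
    refine ⟨fun D hD k => ?_, fun D hD k o D' st => hg o ?_⟩
    · have := good D hD k
      simp only [e, p, dif_pos this, Equiv.symm_apply_apply]
    · rintro rfl
      obtain ⟨h, H, hh⟩ := hD
      rcases hreg.eq_or_mem ((H₁.append H₂).append H) st with h' | h'
      · exact hv h'
      · rcases List.mem_append.1 h' with h' | h'
        · exact (av₁.append av₂).1 h'
        · obtain ⟨u, hu⟩ := hh o h'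
          exact Fin.succAbove_ne o u hu
  have hcard : ∑ k, Fintype.card (T k) = A.totalFanout - 1 := by
    have h₁ : ∑ k, Fintype.card (T k) = Fintype.card (Σ k, T k) := Fintype.card_sigma.symm
    let φ : (Σ k, T k) ≃ {s : Σ k, Fin (A.b k) // s ≠ ⟨i, x⟩} :=
      { toFun := fun s => ⟨⟨s.1, s.2.1⟩, s.2.2⟩
        invFun := fun s => ⟨s.1.1, s.1.2, s.2⟩
        left_inv := fun _ => rfl
        right_inv := fun _ => rfl }
    rw [h₁, Fintype.card_congr φ]
    simp [totalFanout, Fintype.card_subtype_compl]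
  have hpos : 1 ≤ A.totalFanout := by
    have h₁ : 0 < A.b i := Fin.pos x
    have h₂ : A.b i ≤ ∑ k, A.b k :=
      Finset.single_le_sum (f := A.b) (fun _ _ => Nat.zero_le _) (Finset.mem_univ i)
    exact h₁.trans_le h₂
  -- The value of the last completed write at `C`. The alternative `g v` is a dummy: only uniqueness
  -- of that value is needed.
  let v₀ : Fin m :=
    if h : ∃ u, LastCompleted A.initVal (h₁ ++ h₂) u then g h.choose else g v
  have hv₀ : ∀ w, LastCompleted A.initVal (h₁ ++ h₂) (v.succAbove w) → w = v₀ := by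
    intro w hw
    have h : ∃ u, LastCompleted A.initVal (h₁ ++ h₂) u := ⟨_, hw⟩
    simp only [v₀, dif_pos h, h.choose_spec.unique hw, g]
    exact (Function.leftInverse_invFun Fin.succAbove_right_injective w).symm
  exact ⟨hpos, A.restrict e p v.succAbove g v₀ C, hL.singleWriter hC (H₁.append H₂) hsw,
    hL.regular hC (H₁.append H₂) Fin.succAbove_right_injective hv₀ hreg,
    hL.obstructionFree hC (H₁.append H₂) hof, ⟨j, hL.invisible hC (H₁.append H₂) hinv⟩, hcard⟩

theorem E.le {m n S : ℕ} (H : E m n S) : (m : ℤ) ≤ (S : ℤ) - (n : ℤ) + 1 := by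
  induction m generalizing S with
  | zero =>
    obtain ⟨A, -⟩ := H
    exact A.initVal.elim0
  | succ m ih =>
    rcases Nat.eq_zero_or_pos m with rfl | hm
    · obtain ⟨A, -, -, -, -, rfl⟩ := H
      -- Each register has an initial value, hence at least one value.
      have : ∑ _i : Fin n, 1 ≤ ∑ i, A.b i :=
        Finset.sum_le_sum fun i _ => Fin.pos (A.initMem i)
      simp only [Finset.sum_const, Finset.card_univ, Fintype.card_fin, smul_eq_mul,
        mul_one] at this
      simp only [totalFanout]
      omega
    -- `hS` ensures that the subtraction in `S - 1` is not truncated.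
    · obtain ⟨hS, H'⟩ := H.pred hm
      have := ih H'
      omega

end RegImpl

theorem lemma1 :
    (∀ m n S : ℕ, 2 ≤ m → RegImpl.E m n S → 1 ≤ S ∧ RegImpl.E (m - 1) n (S - 1)) ∧
    (∀ m n S : ℕ, RegImpl.E m n S → (m : ℤ) ≤ (S : ℤ) - (n : ℤ) + 1) := by
  refine ⟨fun m n S hm H => ?_, fun m n S H => H.le⟩
  obtain ⟨m, rfl⟩ : ∃ k, m = k + 1 := ⟨m - 1, by omega⟩
  exact H.pred (by omega)
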